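/- For integers $q\ge 0$, $s_1,\dots,s_q$ and complex numbers $x_1,\dots,x_q$ put $$\mathrm{La}_{s_1,\dots,s_q}(x_1,\dots,x_q)=\sum_{k_1\ge k_2\ge\cdots\ge k_q\ge 1}\frac{x_1^{k_1}\cdots x_q^{k_q}}{k_1^{s_1}\cdots k_q^{s_q}}$$ whenever the series converges absolutely (for $q=0$ this is the constant $1$), and write $(\alpha)_m=\alpha(\alpha+1)\cdots(\alpha+m-1)$. Let $p\ge 1$, let $A_1,\dots,A_p\ge 1$ and $n_1,\dots,n_p\ge 0$ be integers, and let $P\in\mathbb{Q}[X_1,\dots,X_p]$. Then there exist finitely many data consisting of - an integer $q$ with $0\le q\le p$, - integers $s_1,\dots,s_q\ge 1$ with $\sum_{i=1}^q s_i\le\sum_{j=1}^p A_j$, - nonempty subsets $J_1,\dots,J_q$ of $\{1,\dots,p\}$, and - a polynomial $c$ with rational coefficients in the quantities $z_j^{\pm1}$ ($1\le j\le p$) and $(1-z_{j_1}\cdots z_{j_m})^{-1}$ ($m\ge 1$, $1\le j_1<\cdots<j_m\le p$), all depending only on $p$, $P$, $A_1,\dots,A_p$, $n_1,\dots,n_p$,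 such that for all complex numbers $z_1,\dots,z_p$ with $|z_j|>1$ for every $j$ the following holds. The series $$\sum_{k_1\ge\cdots\ge k_p\ge1}\frac{P(k_1,\dots,k_p)}{(k_1)_{n_1+1}^{A_1}\cdots(k_p)_{n_p+1}^{A_p}}\,z_1^{-k_1}\cdots z_p^{-k_p}$$ and all the series $\mathrm{La}_{s_1,\dots,s_q}(1/\widehat z_1,\dots,1/\widehat z_q)$ with $\widehat z_i=\prod_{j\in J_i}z_j$ converge absolutely, and the former is equal to the linear combination of the latter with the values of the corresponding polynomials $c$ as coefficients. -/

import Mathlib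

noncomputable section

namespace MultPolylog

/-- The summation range `k₁ ≥ k₂ ≥ ⋯ ≥ k_p ≥ 1`; for `p = 0` it consists of the empty tuple. -/
def chains (p : ℕ) : Set (Fin p → ℕ) := {k | Antitone k ∧ ∀ i, 1 ≤ k i}

/-- The summand `∏ x_i ^ k_i / k_i ^ s_i` of the large multiple polylogarithm. -/
def laTerm {q : ℕ} (s : Fin q → ℤ) (x : Fin q → ℂ) (k : chains q) : ℂ :=
  ∏ i, x i ^ (k.1 i) / (k.1 i : ℂ) ^ (s i)

/-- The large multiple polylogarithm `La_{s₁,…,s_q}(x₁,…,x_q)`; in depth `0` it equals `1`. -/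
def La {q : ℕ} (s : Fin q → ℤ) (x : Fin q → ℂ) : ℂ := ∑' k : chains q, laTerm s x k

/-- The summand `P(k₁,…,k_p) / ∏ (k_j)_{n_j+1}^{A_j} · ∏ z_j^{-k_j}` of the general multiple
series, where `(α)_m = α(α+1)⋯(α+m-1)`. -/
def seriesTerm {p : ℕ} (P : MvPolynomial (Fin p) ℚ) (A n : Fin p → ℕ) (z : Fin p → ℂ)
    (k : chains p) : ℂ :=
  MvPolynomial.aeval (fun j => (k.1 j : ℂ)) P
    / (∏ j, ((ascPochhammer ℂ (n j + 1)).eval (k.1 j : ℂ)) ^ A j)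
    * ∏ j, z j ^ (-(k.1 j : ℤ))

/-- Names of the quantities in which the coefficients are polynomials. -/
inductive CoeffVar (p : ℕ) : Type
  /-- stands for `z_j` -/
  | var (j : Fin p)
  /-- stands for `z_j⁻¹` -/
  | varInv (j : Fin p)
  /-- stands for `(1 - ∏_{j ∈ J} z_j)⁻¹`, for a nonempty set `J` of indices -/
  | geomInv (J : Finset (Fin p)) (hJ : J.Nonempty)

/-- The value at `z` of the quantity that is named by an element of `CoeffVar p`. -/
def CoeffVar.value {p : ℕ} (z : Fin p → ℂ) : CoeffVar p → ℂ
  | .var j => z j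
  | .varInv j => (z j)⁻¹
  | .geomInv J _ => (1 - ∏ j ∈ J, z j)⁻¹

/-- A depth `q`, exponents `s₁,…,s_q`, and sets `J₁,…,J_q` of indices that encode the products
`∏_{j ∈ J_i} z_j`. -/
structure LaIndex (p : ℕ) : Type where
  depth : ℕ
  exps : Fin depth → ℤ
  blocks : Fin depth → Finset (Fin p)

/-- The arguments `1 / ẑ_i`, where `ẑ_i = ∏_{j ∈ J_i} z_j`. -/
def LaIndex.args {p : ℕ} (t : LaIndex p) (z : Fin p → ℂ) : Fin t.depth → ℂ :=
  fun i => 1 / ∏ j ∈ t.blocks i, z j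

end MultPolylog

end

/-!
Fix the inner sums and work modulo forward differences `Δf(k) = f(k + 1) - f(k)`. Partial fractions
split `ρ(k) x ^ k` into a polynomial part and poles `(k + r)⁻ˢ x ^ k`; shifting the index moves a
pole to `r = 0`, which leaves a summand of `Li_s(x)`, and a polynomial part is a difference because
`1 - x` is invertible. Summation by parts then turns the difference in front of an inner sum into
its product with the next summand, in which the two variables are joined and the orders of the
poles add up, and a boundary term. So every truncated sum is a combination of truncated
polylogarithms and of boundary terms, and the latter vanish in the limit since they contain a
factor `ρ(u) x ^ u` with `|x| < 1`.
-/

noncomputable section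

namespace MultPolylog

open Filter Topology Polynomial

section RationalFunctions

variable (F : Type*) [Field F]

/-- The function on `ℕ` defined by a polynomial. The argument is shifted by one, as everywhere
below: the index `k : ℕ` stands for the summation variable `k + 1 ≥ 1`. -/
def evalSucc : F[X] →ₐ[F] (ℕ → F) := aeval fun k : ℕ => (k : F) + 1

/-- The reciprocal of the linear polynomial `X + r`, as a function of the shifted index. -/
def invLinear (r : ℕ) : ℕ → F := fun k => ((k : F) + 1 + r)⁻¹

/-- Rational functions of the shifted index whose poles have order at most `w` and lie at the
nonpositive integers `-r`, `r ∈ I`. -/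
def rationalFunctions (w : ℕ) : Set (ℕ → F) :=
  {ρ | ∃ (I : Finset ℕ) (Q : F[X]), ρ = evalSucc F Q * ∏ r ∈ I, invLinear F r ^ w}

variable {F}

theorem evalSucc_apply (Q : F[X]) (k : ℕ) : evalSucc F Q k = Q.eval ((k : F) + 1) := by
  rw [evalSucc, aeval_fn_apply, coe_aeval_eq_eval]

theorem evalSucc_shift (Q : F[X]) (k : ℕ) : evalSucc F Q (k + 1) = evalSucc F (taylor 1 Q) k := by
  simp [evalSucc_apply, taylor_eval]

theorem invLinear_shift (r k : ℕ) : invLinear F r (k + 1) = invLinear F (r + 1) k := by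
  simp only [invLinear, Nat.cast_add, Nat.cast_one]
  ring

theorem evalSucc_mem_rationalFunctions (w : ℕ) (Q : F[X]) :
    evalSucc F Q ∈ rationalFunctions F w :=
  ⟨∅, Q, by simp⟩

theorem rationalFunctions_shift {w : ℕ} {ρ : ℕ → F} (hρ : ρ ∈ rationalFunctions F w) :
    (fun k => ρ (k + 1)) ∈ rationalFunctions F w := by
  obtain ⟨I, Q, rfl⟩ := hρ
  refine ⟨I.map (addRightEmbedding 1), taylor 1 Q, ?_⟩
  funext k
  simp [evalSucc_shift, invLinear_shift]

variable [CharZero F]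

theorem evalSucc_mul_invLinear (r : ℕ) : evalSucc F (X + C (r : F)) * invLinear F r = 1 := by
  funext k
  have hpole : (k : F) + 1 + r ≠ 0 := by exact_mod_cast (show k + 1 + r ≠ 0 by omega)
  simp [evalSucc_apply, invLinear, hpole]

theorem invLinear_pow_mem_rationalFunctions {w s : ℕ} (r : ℕ) (hs : s ≤ w) :
    invLinear F r ^ s ∈ rationalFunctions F w := by
  refine ⟨{r}, (X + C (r : F)) ^ (w - s), ?_⟩
  rw [Finset.prod_singleton, ← Nat.sub_add_cancel hs, pow_add, Nat.sub_add_cancel hs, map_pow,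
    ← mul_assoc, ← mul_pow, evalSucc_mul_invLinear, one_pow, one_mul]

theorem exists_eq_evalSucc_mul_prod_of_subset {I J : Finset ℕ} (hIJ : I ⊆ J) (w : ℕ) (Q : F[X]) :
    ∃ Q', evalSucc F Q * ∏ r ∈ I, invLinear F r ^ w =
      evalSucc F Q' * ∏ r ∈ J, invLinear F r ^ w := by
  refine ⟨Q * ∏ r ∈ J \ I, (X + C (r : F)) ^ w, ?_⟩
  have hcancel : (∏ r ∈ J \ I, evalSucc F (X + C (r : F)) ^ w) *
      ∏ r ∈ J \ I, invLinear F r ^ w = 1 := by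
    simp only [← Finset.prod_mul_distrib, ← mul_pow, evalSucc_mul_invLinear, one_pow,
      Finset.prod_const_one]
  rw [← Finset.prod_sdiff hIJ]
  simp only [map_mul, map_prod, map_pow]
  linear_combination (-(evalSucc F Q * ∏ r ∈ I, invLinear F r ^ w)) * hcancel

theorem mul_mem_rationalFunctions {v w : ℕ} {ρ σ : ℕ → F} (hρ : ρ ∈ rationalFunctions F v)
    (hσ : σ ∈ rationalFunctions F w) : ρ * σ ∈ rationalFunctions F (v + w) := by
  obtain ⟨I, P, rfl⟩ := hρ
  obtain ⟨J, Q, rfl⟩ := hσ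
  obtain ⟨P', hP'⟩ :=
    exists_eq_evalSucc_mul_prod_of_subset (Finset.subset_union_left : I ⊆ I ∪ J) v P
  obtain ⟨Q', hQ'⟩ :=
    exists_eq_evalSucc_mul_prod_of_subset (Finset.subset_union_right : J ⊆ I ∪ J) w Q
  refine ⟨I ∪ J, P' * Q', ?_⟩
  simp only [hP', hQ', map_mul, pow_add, Finset.prod_mul_distrib]
  ring

theorem exists_partialFractions {w : ℕ} {ρ : ℕ → F} (hρ : ρ ∈ rationalFunctions F w) :
    ∃ (Q : F[X]) (I : Finset ℕ) (c : ℕ → Fin w → F),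
      ρ = evalSucc F Q + ∑ r ∈ I, ∑ s, c r s • invLinear F r ^ (s.1 + 1) := by
  obtain ⟨I, P, rfl⟩ := hρ
  let : Algebra F[X] (ℕ → F) := (evalSucc F).toAlgebra
  have hcoprime : Set.Pairwise (I : Set ℕ) fun r s : ℕ =>
      IsCoprime (X + C (r : F)) (X + C (s : F)) := fun r _ s _ hrs => by
    have hne : -(r : F) - -(s : F) ≠ 0 := sub_ne_zero.2 (by simpa using hrs)
    simpa using isCoprime_X_sub_C_of_isUnit_sub hne.isUnit
  obtain ⟨Q, R, hR, hρ⟩ := mul_prod_pow_inverse_eq_quo_add_sum_rem_mul_pow_inverse (K := ℕ → F) P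
    (g := fun r : ℕ => X + C (r : F)) (fun r _ => monic_X_add_C (r : F)) hcoprime (fun _ => w)
    (gi := invLinear F) fun r _ => (mul_comm _ _).trans (evalSucc_mul_invLinear r)
  refine ⟨Q, I, fun r s => (R r s).coeff 0, hρ.trans ?_⟩
  refine congrArg _ (Finset.sum_congr rfl fun r hr => Finset.sum_congr rfl fun s _ => ?_)
  have hconst : R r s = C ((R r s).coeff 0) :=
    eq_C_of_degree_le_zero (Nat.WithBot.lt_one_iff_le_zero.1 (degree_X_add_C (r : F) ▸ hR r hr s))
  calc evalSucc F (R r s) * invLinear F r ^ (s.1 + 1)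
      = evalSucc F (C ((R r s).coeff 0)) * invLinear F r ^ (s.1 + 1) := by rw [← hconst]
    _ = (R r s).coeff 0 • invLinear F r ^ (s.1 + 1) := by
      rw [Algebra.smul_def, ← (evalSucc F).commutes, algebraMap_eq]

end RationalFunctions

section GeometricTerms

variable {R S : Type*} [CommRing R] [CommRing S]

variable (R) in
/-- The forward difference `Δf(k) = f(k + 1) - f(k)` as a linear map on sequences. -/
def forwardDiff : (ℕ → R) →ₗ[R] (ℕ → R) := LinearMap.funLeft R R Nat.succ - LinearMap.id

theorem forwardDiff_apply (f : ℕ → R) (k : ℕ) : forwardDiff R f k = f (k + 1) - f k := rfl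

variable [Algebra ℚ R] [Algebra ℚ S]

/-- The sequence `ρ(k) x ^ (k + 1)`, linear in the rational coefficients `ρ`. -/
def geomTerm (x : R) : (ℕ → ℚ) →ₗ[ℚ] (ℕ → R) :=
  LinearMap.mulRight ℚ (fun k => x ^ (k + 1)) ∘ₗ (Algebra.linearMap ℚ R).compLeft ℕ

/-- The combinations of sequences `ρ(k) x ^ (k + 1)` where the rational function `ρ` has poles of
order at most `w`. -/
def geomTerms (x : R) (w : ℕ) : Submodule R (ℕ → R) :=
  Submodule.span R (geomTerm x '' rationalFunctions ℚ w)

/-- The summand `x ^ k / k ^ s` of the polylogarithm `Li_s(x)`, in the shifted index. -/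
def polylogTerm (x : R) (s : ℕ) : ℕ → R := geomTerm x (invLinear ℚ 0 ^ s)

/-- The combinations of summands of polylogarithms at `x` with exponents between `1` and `w`. -/
def polylogTerms (x : R) (w : ℕ) : Submodule R (ℕ → R) :=
  Submodule.span R (polylogTerm x '' Set.Icc 1 w)

theorem geomTerm_apply (x : R) (ρ : ℕ → ℚ) (k : ℕ) :
    geomTerm x ρ k = algebraMap ℚ R (ρ k) * x ^ (k + 1) := rfl

theorem map_geomTerm (φ : R →ₐ[ℚ] S) (x : R) (ρ : ℕ → ℚ) (k : ℕ) :
    φ (geomTerm x ρ k) = geomTerm (φ x) ρ k := by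
  simp [geomTerm_apply]

theorem geomTerm_mul_geomTerm (x y : R) (ρ σ : ℕ → ℚ) :
    geomTerm x ρ * geomTerm y σ = geomTerm (x * y) (ρ * σ) := by
  funext k
  simp only [Pi.mul_apply, geomTerm_apply, map_mul, mul_pow]
  ring

theorem geomTerm_succ (x : R) (ρ : ℕ → ℚ) (k : ℕ) :
    geomTerm x ρ (k + 1) = x * geomTerm x (fun k => ρ (k + 1)) k := by
  simp only [geomTerm_apply]
  ring

theorem forwardDiff_geomTerm (x : R) (ρ : ℕ → ℚ) :
    forwardDiff R (geomTerm x ρ) = x • geomTerm x (fun k => ρ (k + 1)) - geomTerm x ρ :=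
  funext fun k => congrArg (· - geomTerm x ρ k) (geomTerm_succ x ρ k)

theorem geomTerm_mem_geomTerms (x : R) {w : ℕ} {ρ : ℕ → ℚ} (hρ : ρ ∈ rationalFunctions ℚ w) :
    geomTerm x ρ ∈ geomTerms x w :=
  Submodule.subset_span ⟨ρ, hρ, rfl⟩

theorem map_mem_geomTerms (φ : R →ₐ[ℚ] S) {x : R} {w : ℕ} {f : ℕ → R} (hf : f ∈ geomTerms x w) :
    φ ∘ f ∈ geomTerms (φ x) w := by
  induction hf using Submodule.span_induction with
  | mem f hf =>
    obtain ⟨ρ, hρ, rfl⟩ := hf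
    exact Submodule.subset_span ⟨ρ, hρ, funext fun k => (map_geomTerm φ x ρ k).symm⟩
  | zero => exact (funext fun _ => map_zero φ : φ ∘ (0 : ℕ → R) = 0) ▸ zero_mem _
  | add f g _ _ ihf ihg => exact (funext fun _ => map_add φ _ _ : φ ∘ (f + g) = _) ▸ add_mem ihf ihg
  | smul a f _ ih =>
    exact (funext fun _ => map_mul φ _ _ : φ ∘ (a • f) = _) ▸ Submodule.smul_mem _ (φ a) ih

theorem polylogTerm_mem_geomTerms (x : R) {s w : ℕ} (hs : s ≤ w) :
    polylogTerm x s ∈ geomTerms x w :=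
  geomTerm_mem_geomTerms x (invLinear_pow_mem_rationalFunctions 0 hs)

theorem mul_mem_geomTerms {x y : R} {v w : ℕ} {f g : ℕ → R} (hf : f ∈ geomTerms x v)
    (hg : g ∈ geomTerms y w) : f * g ∈ geomTerms (x * y) (v + w) := by
  have hmul := Submodule.mul_mem_mul hf hg
  rw [geomTerms, geomTerms, Submodule.span_mul_span] at hmul
  refine Submodule.span_mono ?_ hmul
  rintro _ ⟨_, ⟨ρ, hρ, rfl⟩, _, ⟨σ, hσ, rfl⟩, rfl⟩
  exact ⟨ρ * σ, mul_mem_rationalFunctions hρ hσ, (geomTerm_mul_geomTerm x y ρ σ).symm⟩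

theorem geomTerms_shift {x : R} {w : ℕ} {f : ℕ → R} (hf : f ∈ geomTerms x w) :
    (fun k => f (k + 1)) ∈ geomTerms x w := by
  suffices geomTerms x w ≤ (geomTerms x w).comap (LinearMap.funLeft R R Nat.succ) from this hf
  refine Submodule.span_le.2 ?_
  rintro _ ⟨ρ, hρ, rfl⟩
  have hsucc : LinearMap.funLeft R R Nat.succ (geomTerm x ρ) =
      x • geomTerm x (fun k => ρ (k + 1)) := funext (geomTerm_succ x ρ)
  rw [SetLike.mem_coe, Submodule.mem_comap, hsucc]
  exact Submodule.smul_mem _ _ (geomTerm_mem_geomTerms x (rationalFunctions_shift hρ))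

/-- The span of the summands of polylogarithms at `x` with exponents between `1` and `w`, and of
the forward differences of the combinations of geometric terms; it turns out to contain all
geometric terms. -/
def polylogTermsModDiff (x : R) (w : ℕ) : Submodule R (ℕ → R) :=
  polylogTerms x w ⊔ (geomTerms x w).map (forwardDiff R)

theorem forwardDiff_geomTerm_mem (x : R) {w : ℕ} {ρ : ℕ → ℚ} (hρ : ρ ∈ rationalFunctions ℚ w) :
    forwardDiff R (geomTerm x ρ) ∈ polylogTermsModDiff x w :=
  Submodule.mem_sup_right (Submodule.mem_map_of_mem (geomTerm_mem_geomTerms x hρ))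

theorem geomTerm_evalSucc_mem {x : R} (hx : IsUnit (1 - x)) (w : ℕ) (Q : ℚ[X]) :
    geomTerm x (evalSucc ℚ Q) ∈ polylogTermsModDiff x w := by
  induction hd : Q.degree using WellFoundedLT.induction generalizing Q with
  | ind d ih =>
    rcases eq_or_ne Q 0 with rfl | hQ
    · simp
    have hdeg : (taylor 1 Q - Q).degree < d :=
      hd ▸ degree_taylor Q (1 : ℚ) ▸
        degree_sub_lt_left (degree_taylor Q 1) (by simpa using hQ) (leadingCoeff_taylor 1 Q)
    have hlower := ih _ hdeg (taylor 1 Q - Q) rfl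
    have hdiff := forwardDiff_geomTerm_mem x (evalSucc_mem_rationalFunctions w Q)
    have hshift : (fun k => evalSucc ℚ Q (k + 1)) = evalSucc ℚ (taylor 1 Q) :=
      funext (evalSucc_shift Q)
    rw [← Submodule.smul_mem_iff_of_isUnit _ hx]
    convert Submodule.sub_mem _ (Submodule.smul_mem _ x hlower) hdiff using 1
    rw [forwardDiff_geomTerm, hshift, map_sub, map_sub]
    module

theorem geomTerm_invLinear_pow_mem {x : R} (hx : IsUnit x) {s w : ℕ} (hs : s ∈ Set.Icc 1 w)
    (r : ℕ) : geomTerm x (invLinear ℚ r ^ s) ∈ polylogTermsModDiff x w := by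
  induction r with
  | zero => exact Submodule.mem_sup_left (Submodule.subset_span ⟨s, hs, rfl⟩)
  | succ r ih =>
    have hshift : (fun k => (invLinear ℚ r ^ s) (k + 1)) = invLinear ℚ (r + 1) ^ s :=
      funext fun k => by simp only [Pi.pow_apply, invLinear_shift]
    have hdiff := forwardDiff_geomTerm_mem x (invLinear_pow_mem_rationalFunctions r hs.2)
    rw [← Submodule.smul_mem_iff_of_isUnit _ hx]
    convert Submodule.add_mem _ hdiff ih using 1
    rw [forwardDiff_geomTerm, hshift, sub_add_cancel]

theorem geomTerms_le_polylogTermsModDiff {x : R} (hx : IsUnit x) (hx' : IsUnit (1 - x)) (w : ℕ) :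
    geomTerms x w ≤ polylogTermsModDiff x w := by
  refine Submodule.span_le.2 ?_
  rintro _ ⟨ρ, hρ, rfl⟩
  obtain ⟨Q, I, c, rfl⟩ := exists_partialFractions hρ
  simp only [map_add, map_sum, map_smul]
  refine Submodule.add_mem _ (geomTerm_evalSucc_mem hx' w Q)
    (Submodule.sum_mem _ fun r _ => Submodule.sum_mem _ fun s _ => ?_)
  exact Submodule.smul_of_tower_mem _ _ (geomTerm_invLinear_pow_mem hx ⟨s.1.succ_pos, s.2⟩ r)

end GeometricTerms

section NestedSums

variable {R S : Type*} [CommRing R] [CommRing S]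

variable (R) in
/-- The sequence of partial sums `u ↦ ∑_{k ≤ u} f(k)` as a linear map. -/
def partialSum : (ℕ → R) →ₗ[R] (ℕ → R) :=
  LinearMap.pi fun u => ∑ k ∈ Finset.range (u + 1), LinearMap.proj k

/-- The truncated nested sum `u ↦ ∑_{u ≥ k₁ ≥ ⋯ ≥ k_q ≥ 0} f₁(k₁) ⋯ f_q(k_q)`. -/
def nestedSum : List (ℕ → R) → ℕ → R
  | [] => 1
  | f :: l => partialSum R (f * nestedSum l)

theorem partialSum_apply (f : ℕ → R) (u : ℕ) :
    partialSum R f u = ∑ k ∈ Finset.range (u + 1), f k := by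
  simp [partialSum]

theorem partialSum_zero (f : ℕ → R) : partialSum R f 0 = f 0 := by
  simp [partialSum_apply]

theorem partialSum_succ (f : ℕ → R) (u : ℕ) :
    partialSum R f (u + 1) = partialSum R f u + f (u + 1) := by
  simp only [partialSum_apply, Finset.sum_range_succ _ (u + 1)]

theorem partialSum_forwardDiff (f : ℕ → R) :
    partialSum R (forwardDiff R f) = (fun k => f (k + 1)) - f 0 • 1 := by
  funext u
  rw [partialSum_apply]
  simpa [forwardDiff_apply] using Finset.sum_range_sub f (u + 1)

theorem partialSum_forwardDiff_mul_partialSum (f g : ℕ → R) :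
    partialSum R (forwardDiff R f * partialSum R g) =
      (fun k => f (k + 1)) * partialSum R g - partialSum R (f * g) := by
  funext u
  induction u with
  | zero =>
    simp only [Pi.mul_apply, Pi.sub_apply, partialSum_zero, forwardDiff_apply]
    ring
  | succ u ih =>
    simp only [Pi.mul_apply, Pi.sub_apply, partialSum_succ, forwardDiff_apply] at ih ⊢
    linear_combination ih

theorem map_nestedSum (φ : R →+* S) (l : List (ℕ → R)) (u : ℕ) :
    φ (nestedSum l u) = nestedSum (l.map (φ ∘ ·)) u := by
  induction l generalizing u with
  | nil => exact map_one φ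
  | cons f l ih => simp [nestedSum, partialSum_apply, ih]

end NestedSums

section Reduction

variable {ι R S : Type*} [CommRing R] [CommRing S]

/-- The product of the variables `y j` of a block `B`. -/
def blockProd (y : ι → R) (B : Multiset ι) : R := (B.map y).prod

theorem blockProd_add (y : ι → R) (B C : Multiset ι) :
    blockProd y (B + C) = blockProd y B * blockProd y C := by
  rw [blockProd, Multiset.map_add, Multiset.prod_add, blockProd, blockProd]

theorem isUnit_blockProd {y : ι → R} (hy : ∀ j, IsUnit (y j)) (B : Multiset ι) :
    IsUnit (blockProd y B) := by
  rw [blockProd, IsUnit.multisetProd_iff]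
  simpa using fun j _ => hy j

theorem map_blockProd (φ : R →+* S) (y : ι → R) (B : Multiset ι) :
    φ (blockProd y B) = blockProd (φ ∘ y) B := by
  rw [blockProd, map_multiset_prod, Multiset.map_map, blockProd]

/-- A list of blocks of variables, each with an exponent, encodes an iterated sum: a block `B` with
exponent `s` stands for the summand of the polylogarithm `Li_s` at the product of `B`. The list is
reduced if all its blocks are nonempty and all its exponents positive. Being pairs, the entries can
be added, which joins the blocks and adds the exponents. -/
def IsReduced (L : List (Multiset ι × ℕ)) : Prop := ∀ b ∈ L, b.1 ≠ 0 ∧ 1 ≤ b.2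

theorem IsReduced.length_le_card {L : List (Multiset ι × ℕ)} (hL : IsReduced L) :
    L.length ≤ L.sum.1.card := by
  induction L with
  | nil => exact Nat.zero_le _
  | cons b L ih =>
    obtain ⟨hb, hL⟩ := List.forall_mem_cons.1 hL
    have hcard := Multiset.card_pos.2 hb.1
    have hlength := ih hL
    simp only [List.length_cons, List.sum_cons, Prod.fst_add, Multiset.card_add]
    omega

variable [Algebra ℚ R] [Algebra ℚ S]

/-- The truncated nested sum of the summands of polylogarithms that are encoded by a list of blocks
with exponents. -/
def nestedPolylog (y : ι → R) (L : List (Multiset ι × ℕ)) : ℕ → R :=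
  nestedSum (L.map fun b => polylogTerm (blockProd y b.1) b.2)

/-- The combinations of truncated nested sums of polylogarithms, and of products of those with a
geometric term, whose blocks and exponents add up to at most `T`. -/
def reducedSums (y : ι → R) (T : Multiset ι × ℕ) : Submodule R (ℕ → R) :=
  Submodule.span R
    ({f | ∃ L, IsReduced L ∧ L.sum ≤ T ∧ nestedPolylog y L = f} ∪
      {f | ∃ b L, ∃ g ∈ geomTerms (blockProd y b.1) b.2,
        b.1 ≠ 0 ∧ IsReduced L ∧ b + L.sum ≤ T ∧ g * nestedPolylog y L = f})

theorem map_nestedPolylog (φ : R →ₐ[ℚ] S) (y : ι → R) (L : List (Multiset ι × ℕ)) (u : ℕ) :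
    φ (nestedPolylog y L u) = nestedPolylog (φ ∘ y) L u := by
  rw [nestedPolylog, ← RingHom.coe_coe φ, map_nestedSum, List.map_map, nestedPolylog]
  congr 2
  funext b k
  exact (map_geomTerm φ _ _ k).trans (congrArg (geomTerm · _ k) (map_blockProd (φ : R →+* S) y b.1))

theorem nestedPolylog_mem_reducedSums (y : ι → R) {T : Multiset ι × ℕ} {L : List (Multiset ι × ℕ)}
    (hL : IsReduced L) (hT : L.sum ≤ T) : nestedPolylog y L ∈ reducedSums y T :=
  Submodule.subset_span (Or.inl ⟨L, hL, hT, rfl⟩)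

theorem geomTerm_mul_nestedPolylog_mem_reducedSums {y : ι → R} {T b : Multiset ι × ℕ}
    {L : List (Multiset ι × ℕ)} {g : ℕ → R} (hg : g ∈ geomTerms (blockProd y b.1) b.2)
    (hb : b.1 ≠ 0) (hL : IsReduced L) (hT : b + L.sum ≤ T) :
    g * nestedPolylog y L ∈ reducedSums y T :=
  Submodule.subset_span (Or.inr ⟨b, L, g, hg, hb, hL, hT, rfl⟩)

theorem mul_mem_geomTerms_blockProd {y : ι → R} {b c : Multiset ι × ℕ} {f g : ℕ → R}
    (hf : f ∈ geomTerms (blockProd y b.1) b.2) (hg : g ∈ geomTerms (blockProd y c.1) c.2) :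
    f * g ∈ geomTerms (blockProd y (b + c).1) (b + c).2 := by
  rw [Prod.fst_add, Prod.snd_add, blockProd_add]
  exact mul_mem_geomTerms hf hg

theorem partialSum_mul_nestedPolylog_mem_of_forwardDiff {y : ι → R} {T b : Multiset ι × ℕ}
    (hy : ∀ j, IsUnit (y j)) (hy' : IsUnit (1 - blockProd y b.1)) (hb : b.1 ≠ 0)
    {L : List (Multiset ι × ℕ)} (hL : IsReduced L) (hT : b + L.sum ≤ T)
    (hdiff : ∀ g ∈ geomTerms (blockProd y b.1) b.2,
      partialSum R (forwardDiff R g * nestedPolylog y L) ∈ reducedSums y T)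
    {h : ℕ → R} (hh : h ∈ geomTerms (blockProd y b.1) b.2) :
    partialSum R (h * nestedPolylog y L) ∈ reducedSums y T := by
  let Φ : (ℕ → R) →ₗ[R] (ℕ → R) := partialSum R ∘ₗ LinearMap.mulRight R (nestedPolylog y L)
  suffices hle : polylogTermsModDiff (blockProd y b.1) b.2 ≤ (reducedSums y T).comap Φ from
    hle (geomTerms_le_polylogTermsModDiff (isUnit_blockProd hy b.1) hy' b.2 hh)
  refine sup_le (Submodule.span_le.2 ?_) (Submodule.map_le_iff_le_comap.2 hdiff)
  rintro _ ⟨s, ⟨hs, hsb⟩, rfl⟩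
  have hbs : (b.1, s) ≤ b := ⟨le_rfl, hsb⟩
  refine nestedPolylog_mem_reducedSums y (L := (b.1, s) :: L)
    (List.forall_mem_cons.2 ⟨⟨hb, hs⟩, hL⟩) ?_
  rw [List.sum_cons]
  exact (add_le_add_left hbs L.sum).trans hT

/-- Summation by parts joins the block of `h` with the first block of `L`, so the induction is on
the length of `L`. -/
theorem partialSum_mul_nestedPolylog_mem_reducedSums {y : ι → R} {T : Multiset ι × ℕ}
    (hy : ∀ j, IsUnit (y j)) (hy' : ∀ B ≤ T.1, B ≠ 0 → IsUnit (1 - blockProd y B))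
    {L : List (Multiset ι × ℕ)} (hL : IsReduced L) {b : Multiset ι × ℕ} (hb : b.1 ≠ 0)
    (hT : b + L.sum ≤ T) {h : ℕ → R} (hh : h ∈ geomTerms (blockProd y b.1) b.2) :
    partialSum R (h * nestedPolylog y L) ∈ reducedSums y T := by
  induction L generalizing b h with
  | nil =>
    refine partialSum_mul_nestedPolylog_mem_of_forwardDiff hy
      (hy' b.1 (le_self_add.trans hT.1) hb) hb hL hT (fun g hg => ?_) hh
    have hboundary := geomTerm_mul_nestedPolylog_mem_reducedSums (geomTerms_shift hg) hb hL hT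
    have hconst := nestedPolylog_mem_reducedSums y hL (le_add_self.trans hT)
    convert Submodule.sub_mem _ hboundary (Submodule.smul_mem _ (g 0) hconst) using 1
    simp only [nestedPolylog, List.map_nil, nestedSum, mul_one, partialSum_forwardDiff]
  | cons c L ih =>
    refine partialSum_mul_nestedPolylog_mem_of_forwardDiff hy
      (hy' b.1 (le_self_add.trans hT.1) hb) hb hL hT (fun g hg => ?_) hh
    have hboundary := geomTerm_mul_nestedPolylog_mem_reducedSums (geomTerms_shift hg) hb hL hT
    have hjoin : partialSum R (g * polylogTerm (blockProd y c.1) c.2 * nestedPolylog y L) ∈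
        reducedSums y T :=
      ih (List.forall_mem_cons.1 hL).2 (b := b + c) (by simp [hb])
        (by rwa [add_assoc, ← List.sum_cons])
        (mul_mem_geomTerms_blockProd hg (polylogTerm_mem_geomTerms _ le_rfl))
    convert Submodule.sub_mem _ hboundary hjoin using 1
    simp only [nestedPolylog, List.map_cons, nestedSum, partialSum_forwardDiff_mul_partialSum,
      mul_assoc]

theorem nestedSum_mem_reducedSums {y : ι → R} (hy : ∀ j, IsUnit (y j)) {fs : List (ℕ → R)}
    {bs : List (Multiset ι × ℕ)}
    (hfs : List.Forall₂ (fun f b => b.1 ≠ 0 ∧ f ∈ geomTerms (blockProd y b.1) b.2) fs bs)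
    (hy' : ∀ B ≤ bs.sum.1, B ≠ 0 → IsUnit (1 - blockProd y B)) :
    nestedSum fs ∈ reducedSums y bs.sum := by
  induction hfs with
  | nil => exact nestedPolylog_mem_reducedSums y (L := []) (by simp [IsReduced]) le_rfl
  | @cons f b fs bs hf _ ih =>
    rw [List.sum_cons] at hy' ⊢
    let Φ : (ℕ → R) →ₗ[R] (ℕ → R) := partialSum R ∘ₗ LinearMap.mulLeft R f
    suffices hle : reducedSums y bs.sum ≤ (reducedSums y (b + bs.sum)).comap Φ from
      hle (ih fun B hB => hy' B (hB.trans le_add_self))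
    refine Submodule.span_le.2 ?_
    rintro _ (⟨L, hL, hT, rfl⟩ | ⟨c, L, g, hg, -, hL, hT, rfl⟩)
    · exact partialSum_mul_nestedPolylog_mem_reducedSums hy hy' hL hf.1
        (add_le_add_right hT b) hf.2
    · change partialSum R (f * (g * nestedPolylog y L)) ∈ reducedSums y (b + bs.sum)
      rw [← mul_assoc]
      refine partialSum_mul_nestedPolylog_mem_reducedSums hy hy' hL (b := b + c)
        (by simp [hf.1]) ?_ (mul_mem_geomTerms_blockProd hf.2 hg)
      rw [add_assoc]
      exact add_le_add_right hT b

end Reduction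

section NestedSeries

theorem antitone_cons_iff {α : Type*} [Preorder α] {p : ℕ} {a : α} {t : Fin p → α} :
    Antitone (Fin.cons a t : Fin (p + 1) → α) ↔ (∀ i, t i ≤ a) ∧ Antitone t := by
  simp [Antitone, Fin.forall_fin_succ]

theorem nestedSum_ofFn {R : Type*} [CommRing R] {p : ℕ} (f : Fin p → ℕ → R) (u : ℕ) :
    nestedSum (List.ofFn f) u = ∑ t ∈ Fintype.piFinset fun _ => Finset.range (u + 1),
      {t : Fin p → ℕ | Antitone t}.indicator (fun t => ∏ j, f j (t j)) t := by
  classical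
  simp only [Set.indicator_apply, Set.mem_ofPred_eq, ← Finset.sum_filter]
  induction p generalizing u with
  | zero => simp [nestedSum, Subsingleton.antitone]
  | succ p ih =>
    simp only [List.ofFn_succ, nestedSum, partialSum_apply, Pi.mul_apply, ih, Finset.mul_sum]
    rw [Finset.sum_sigma']
    refine Finset.sum_bij' (fun x _ => (Fin.cons x.1 x.2 : Fin (p + 1) → ℕ))
      (fun t _ => ⟨t 0, Fin.tail t⟩) ?_ ?_ (fun _ _ => by simp) (fun _ _ => by simp)
      (fun _ _ => by simp [Fin.prod_univ_succ])
    · rintro ⟨k, t⟩ h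
      simp only [Finset.mem_sigma, Finset.mem_range, Finset.mem_filter, Fintype.mem_piFinset,
        Nat.lt_succ_iff] at h ⊢
      exact ⟨Fin.forall_fin_succ.2 ⟨h.1, fun i => (h.2.1 i).trans h.1⟩, antitone_cons_iff.2 h.2⟩
    · intro t h
      simp only [Finset.mem_sigma, Finset.mem_range, Finset.mem_filter, Fintype.mem_piFinset,
        Nat.lt_succ_iff] at h ⊢
      rw [← Fin.cons_self_tail t, antitone_cons_iff] at h
      exact ⟨h.1 0, h.2⟩

/-- Chains of natural numbers correspond to chains of positive integers by adding one. -/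
def antitoneEquivChains (p : ℕ) : {t : Fin p → ℕ // Antitone t} ≃ chains p where
  toFun t := ⟨fun i => t.1 i + 1, fun _ _ h => Nat.succ_le_succ (t.2 h), fun i => (t.1 i).succ_pos⟩
  invFun k := ⟨fun i => k.1 i - 1, fun _ _ h => Nat.sub_le_sub_right (k.2.1 h) 1⟩
  left_inv _ := rfl
  right_inv k := by
    ext i
    exact Nat.sub_add_cancel (k.2.2 i)

/-- The summand `∏ f_i(k_i - 1)` of the nested series over `k₁ ≥ ⋯ ≥ k_p ≥ 1` of sequences that
are indexed from zero. -/
def chainTerm {R : Type*} [CommMonoid R] {p : ℕ} (f : Fin p → ℕ → R) (k : chains p) : R :=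
  ∏ i, f i (k.1 i - 1)

theorem chainTerm_comp_antitoneEquivChains {R : Type*} [CommMonoid R] {p : ℕ}
    (f : Fin p → ℕ → R) :
    chainTerm f ∘ antitoneEquivChains p = (fun t => ∏ j, f j (t j)) ∘ Subtype.val := rfl

variable {R : Type*} [NormedCommRing R] {p : ℕ} {f : Fin p → ℕ → R}

theorem summable_norm_prod (hf : ∀ j, Summable fun k => ‖f j k‖) :
    Summable fun t : Fin p → ℕ => ‖∏ j, f j (t j)‖ := by
  induction p with
  | zero => exact .of_finite
  | succ p ih =>
    rw [← (Fin.consEquiv fun _ : Fin (p + 1) => ℕ).summable_iff]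
    refine ((hf 0).mul_norm (ih fun j => hf j.succ)).congr fun x => ?_
    simp [Fin.prod_univ_succ, Fin.consEquiv]

variable [CompleteSpace R]

theorem summable_chainTerm (hf : ∀ j, Summable fun k => ‖f j k‖) : Summable (chainTerm f) := by
  rw [← (antitoneEquivChains p).summable_iff, chainTerm_comp_antitoneEquivChains]
  exact (summable_norm_prod hf).of_norm.comp_injective Subtype.val_injective

theorem tendsto_nestedSum_ofFn (hf : ∀ j, Summable fun k => ‖f j k‖) :
    Tendsto (nestedSum (List.ofFn f)) atTop (𝓝 (∑' k, chainTerm f k)) := by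
  have hsum : HasSum ({t : Fin p → ℕ | Antitone t}.indicator fun t => ∏ j, f j (t j))
      (∑' k, chainTerm f k) := by
    rw [← hasSum_subtype_iff_indicator]
    have hchains := (antitoneEquivChains p).hasSum_iff.2 (summable_chainTerm hf).hasSum
    rwa [chainTerm_comp_antitoneEquivChains] at hchains
  have hboxes : Tendsto (fun u : ℕ => Fintype.piFinset fun _ : Fin p => Finset.range (u + 1))
      atTop atTop := by
    refine tendsto_atTop_finset_of_monotone (fun u v huv => ?_) fun t => ⟨∑ j, t j, ?_⟩
    · exact Fintype.piFinset_subset _ _ fun _ => Finset.range_mono (Nat.succ_le_succ huv)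
    · simpa [Nat.lt_succ_iff] using fun i => Finset.single_le_sum_of_canonicallyOrdered
        (f := t) (Finset.mem_univ i)
  exact (hsum.comp hboxes).congr fun u => (nestedSum_ofFn f u).symm

end NestedSeries

section Convergence

theorem norm_blockProd_lt_one {ι : Type*} {y : ι → ℂ} (hy : ∀ j, ‖y j‖ < 1) {B : Multiset ι}
    (hB : B ≠ 0) : ‖blockProd y B‖ < 1 :=
  Multiset.prod_induction_nonempty (fun x => ‖x‖ < 1)
    (fun a b ha hb => (norm_mul a b).trans_lt (mul_lt_one_of_nonneg_of_lt_one_left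
      (norm_nonneg a) ha hb.le)) (by simpa using hB) (by simpa using fun j _ => hy j)

theorem abs_invLinear_le_one (r k : ℕ) : |invLinear ℚ r k| ≤ 1 := by
  rw [invLinear, abs_inv]
  refine inv_le_one_of_one_le₀ ((le_abs_self _).trans' ?_)
  exact_mod_cast (show 1 ≤ k + 1 + r by omega)

theorem summable_norm_geomTerm_evalSucc {x : ℂ} (hx : ‖x‖ < 1) (Q : ℚ[X]) :
    Summable fun k => ‖geomTerm x (evalSucc ℚ Q) k‖ := by
  induction Q using Polynomial.induction_on' with
  | add P Q hP hQ =>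
    refine (hP.add hQ).of_nonneg_of_le (fun _ => norm_nonneg _) fun k => ?_
    rw [map_add, map_add]
    exact norm_add_le _ _
  | monomial a c =>
    have hmonomial := (summable_nat_add_iff 1).2
      (summable_norm_pow_mul_geometric_of_norm_lt_one a hx)
    refine (hmonomial.mul_left ‖(c : ℂ)‖).congr fun k => ?_
    simp [geomTerm_apply, evalSucc_apply, mul_assoc]

theorem summable_norm_geomTerm {x : ℂ} (hx : ‖x‖ < 1) {w : ℕ} {ρ : ℕ → ℚ}
    (hρ : ρ ∈ rationalFunctions ℚ w) : Summable fun k => ‖geomTerm x ρ k‖ := by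
  obtain ⟨I, Q, rfl⟩ := hρ
  refine (summable_norm_geomTerm_evalSucc hx Q).of_nonneg_of_le (fun _ => norm_nonneg _) fun k => ?_
  have hpoles : |(∏ r ∈ I, invLinear ℚ r ^ w) k| ≤ 1 := by
    rw [Finset.prod_apply, Finset.abs_prod]
    refine Finset.prod_le_one (fun _ _ => abs_nonneg _) fun r _ => ?_
    rw [Pi.pow_apply, abs_pow]
    exact pow_le_one₀ (abs_nonneg _) (abs_invLinear_le_one r k)
  simp only [geomTerm_apply, norm_mul, eq_ratCast, Complex.norm_ratCast, Pi.mul_apply, Rat.cast_mul]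
  gcongr
  exact mul_le_of_le_one_right (abs_nonneg _) (by exact_mod_cast hpoles)

theorem summable_norm_polylogTerm {x : ℂ} (hx : ‖x‖ < 1) (s : ℕ) :
    Summable fun k => ‖polylogTerm x s k‖ :=
  summable_norm_geomTerm hx (invLinear_pow_mem_rationalFunctions 0 le_rfl)

theorem tendsto_zero_of_mem_geomTerms {x : ℂ} (hx : ‖x‖ < 1) {w : ℕ} {f : ℕ → ℂ}
    (hf : f ∈ geomTerms x w) : Tendsto f atTop (𝓝 0) := by
  suffices geomTerms x w ≤ zeroAtFilterSubmodule ℂ atTop from this hf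
  refine Submodule.span_le.2 ?_
  rintro _ ⟨ρ, hρ, rfl⟩
  exact (summable_norm_geomTerm hx hρ).of_norm.tendsto_atTop_zero

theorem laTerm_natCast {q : ℕ} (s : Fin q → ℕ) (x : Fin q → ℂ) :
    laTerm (fun i => (s i : ℤ)) x = chainTerm fun i => polylogTerm (x i) (s i) := by
  funext k
  refine Finset.prod_congr rfl fun i _ => ?_
  obtain ⟨m, hm⟩ := Nat.exists_eq_succ_of_ne_zero (Nat.one_le_iff_ne_zero.1 (k.2.2 i))
  simp [polylogTerm, geomTerm_apply, invLinear, hm, div_eq_inv_mul]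

theorem summable_laTerm {q : ℕ} {s : Fin q → ℤ} (hs : ∀ i, 0 ≤ s i) {x : Fin q → ℂ}
    (hx : ∀ i, ‖x i‖ < 1) : Summable (laTerm s x) := by
  lift s to Fin q → ℕ using hs
  rw [laTerm_natCast]
  exact summable_chainTerm fun i => summable_norm_polylogTerm (hx i) (s i)

theorem tendsto_nestedPolylog {ι : Type*} {y : ι → ℂ} (hy : ∀ j, ‖y j‖ < 1)
    {L : List (Multiset ι × ℕ)} (hL : IsReduced L) :
    Tendsto (nestedPolylog y L) atTop
      (𝓝 (La (fun i => ((L.get i).2 : ℤ)) fun i => blockProd y (L.get i).1)) := by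
  have hterms : L.map (fun b => polylogTerm (blockProd y b.1) b.2) =
      List.ofFn fun i => polylogTerm (blockProd y (L.get i).1) (L.get i).2 := by
    conv_lhs => rw [← List.ofFn_get L, List.map_ofFn]
    rfl
  rw [La, laTerm_natCast, nestedPolylog, hterms]
  exact tendsto_nestedSum_ofFn fun i =>
    summable_norm_polylogTerm (norm_blockProd_lt_one hy (hL _ (L.get_mem i)).1) _

end Convergence

section Coefficients

variable {p : ℕ}

/-- The domain of the points `z` with `|z_j| > 1` for all `j`. -/
abbrev Region (p : ℕ) : Type := {z : Fin p → ℂ // ∀ j, 1 < ‖z j‖}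

theorem Region.ne_zero (z : Region p) (j : Fin p) : z.1 j ≠ 0 :=
  norm_pos_iff.1 (one_pos.trans (z.2 j))

theorem Region.norm_inv_lt_one (z : Region p) (j : Fin p) : ‖(z.1 j)⁻¹‖ < 1 := by
  rw [norm_inv]
  exact inv_lt_one_of_one_lt₀ (z.2 j)

/-- The function on the region that a polynomial in the named quantities defines. -/
def coeffHom (p : ℕ) : MvPolynomial (CoeffVar p) ℚ →ₐ[ℚ] (Region p → ℂ) :=
  MvPolynomial.aeval fun v z => v.value z.1

theorem coeffHom_apply (f : MvPolynomial (CoeffVar p) ℚ) (z : Region p) :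
    coeffHom p f z = MvPolynomial.aeval (CoeffVar.value z.1) f := by
  have hcomp : (Pi.evalAlgHom ℚ (fun _ : Region p => ℂ) z).comp (coeffHom p) =
      MvPolynomial.aeval (CoeffVar.value z.1) :=
    MvPolynomial.algHom_ext fun v => by simp [coeffHom]
  exact DFunLike.congr_fun hcomp f

/-- The ring of coefficient functions. Working over functions on the region, rather than over the
polynomials that represent them, makes `1 - ∏ 1 / z_j` invertible. -/
abbrev CoeffRing (p : ℕ) : Subalgebra ℚ (Region p → ℂ) := (coeffHom p).range

/-- The evaluation of coefficient functions at a point of the region. -/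
def evalAt (z : Region p) : CoeffRing p →ₐ[ℚ] ℂ :=
  (Pi.evalAlgHom ℚ (fun _ : Region p => ℂ) z).comp (CoeffRing p).val

theorem CoeffRing.ext {f g : CoeffRing p} (h : ∀ z, evalAt z f = evalAt z g) : f = g :=
  Subtype.ext (funext h)

theorem evalAt_coeffHom (z : Region p) (f : MvPolynomial (CoeffVar p) ℚ) :
    evalAt z ((coeffHom p).rangeRestrict f) = MvPolynomial.aeval (CoeffVar.value z.1) f :=
  coeffHom_apply f z

/-- The function `z ↦ 1 / z_j` as an element of the coefficient ring. -/
def invCoord (p : ℕ) (j : Fin p) : CoeffRing p :=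
  (coeffHom p).rangeRestrict (MvPolynomial.X (.varInv j))

theorem evalAt_invCoord (z : Region p) (j : Fin p) : evalAt z (invCoord p j) = (z.1 j)⁻¹ := by
  rw [invCoord, evalAt_coeffHom, MvPolynomial.aeval_X, CoeffVar.value]

theorem evalAt_comp_invCoord (z : Region p) :
    evalAt z ∘ invCoord p = fun j => (z.1 j)⁻¹ :=
  funext (evalAt_invCoord z)

theorem evalAt_blockProd_invCoord (z : Region p) (B : Multiset (Fin p)) :
    evalAt z (blockProd (invCoord p) B) = blockProd (fun j => (z.1 j)⁻¹) B :=
  (map_blockProd (evalAt z : CoeffRing p →+* ℂ) _ B).trans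
    (congrArg (blockProd · B) (evalAt_comp_invCoord z))

theorem isUnit_invCoord (j : Fin p) : IsUnit (invCoord p j) := by
  refine .of_mul_eq_one ((coeffHom p).rangeRestrict (MvPolynomial.X (.var j))) ?_
  refine CoeffRing.ext fun z => ?_
  rw [map_mul, evalAt_invCoord, evalAt_coeffHom, MvPolynomial.aeval_X, CoeffVar.value, map_one,
    inv_mul_cancel₀ (z.ne_zero j)]

theorem isUnit_one_sub_blockProd_invCoord {B : Multiset (Fin p)} (hB : B ≠ 0) (hB' : B.Nodup) :
    IsUnit (1 - blockProd (invCoord p) B) := by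
  let J : Finset (Fin p) := ⟨B, hB'⟩
  have hJ : J.Nonempty := Finset.nonempty_iff_ne_empty.2 fun h => hB (congrArg Finset.val h)
  -- `(1 - 1 / w)⁻¹ = -w (1 - w)⁻¹`
  refine .of_mul_eq_one ((coeffHom p).rangeRestrict
    (-(∏ j ∈ J, MvPolynomial.X (.var j)) * MvPolynomial.X (.geomInv J hJ))) ?_
  refine CoeffRing.ext fun z => ?_
  have hnorm := norm_blockProd_lt_one z.norm_inv_lt_one hB
  have hprod : blockProd (fun j => (z.1 j)⁻¹) B = (∏ j ∈ J, z.1 j)⁻¹ :=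
    Finset.prod_inv_distrib (s := J) z.1
  have hne : ∏ j ∈ J, z.1 j ≠ 0 := Finset.prod_ne_zero_iff.2 fun j _ => z.ne_zero j
  have hne' : 1 - ∏ j ∈ J, z.1 j ≠ 0 := fun h => by
    rw [hprod, ← sub_eq_zero.1 h, inv_one, norm_one] at hnorm
    exact lt_irrefl _ hnorm
  rw [map_mul, map_sub, map_one, evalAt_blockProd_invCoord, hprod, evalAt_coeffHom]
  simp only [map_mul, map_neg, map_prod, MvPolynomial.aeval_X, CoeffVar.value]
  field_simp
  ring

theorem exists_finsupp_of_mem_span_range {K R S α : Type*} [CommSemiring K]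
    [CommSemiring R] [CommSemiring S] [Algebra K R] [Algebra K S] (φ : R →ₐ[K] S) {v : α → S}
    {s : Set α} {g : S} (hg : g ∈ Submodule.span φ.range (v '' s)) :
    ∃ c : α →₀ R, ↑c.support ⊆ s ∧ c.sum (fun t f => φ f * v t) = g := by
  let : Algebra R S := φ.toRingHom.toAlgebra
  let : Algebra R φ.range := φ.rangeRestrict.toRingHom.toAlgebra
  have : IsScalarTower R φ.range S := .of_algebraMap_eq fun _ => rfl
  have hg' : g ∈ Submodule.span R (v '' s) := by
    rwa [← Submodule.restrictScalars_span R φ.range φ.rangeRestrict_surjective]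
  obtain ⟨c, hc, rfl⟩ := (Finsupp.mem_span_image_iff_linearCombination R).1 hg'
  exact ⟨c, (Finsupp.mem_supported R c).1 hc, rfl⟩

end Coefficients

section Series

variable {p : ℕ}

/-- The indices that occur in the theorem: the depth is at most `p`, the exponents are positive with
sum at most `W`, and the blocks are nonempty. -/
def laIndices (p W : ℕ) : Set (LaIndex p) :=
  {t | t.depth ≤ p ∧ (∀ i, 1 ≤ t.exps i) ∧ ∑ i, t.exps i ≤ W ∧ ∀ i, (t.blocks i).Nonempty}

/-- The function `z ↦ La_{s₁,…,s_q}(1/ẑ₁,…,1/ẑ_q)` on the region. -/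
def laFun (t : LaIndex p) (z : Region p) : ℂ := La t.exps (t.args z.1)

theorem LaIndex.args_apply (t : LaIndex p) (z : Fin p → ℂ) (i : Fin t.depth) :
    t.args z i = blockProd (fun j => (z j)⁻¹) (t.blocks i).val :=
  (one_div _).trans (Finset.prod_inv_distrib z).symm

theorem norm_args_lt_one {t : LaIndex p} (ht : ∀ i, (t.blocks i).Nonempty) (z : Region p)
    (i : Fin t.depth) : ‖t.args z.1 i‖ < 1 := by
  rw [t.args_apply]
  exact norm_blockProd_lt_one z.norm_inv_lt_one
    (Finset.val_eq_zero.not.2 (ht i).ne_empty)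

/-- The index that a list of blocks with exponents encodes; the blocks are meant to be free of
repetitions. -/
def toLaIndex (L : List (Multiset (Fin p) × ℕ)) : LaIndex p where
  depth := L.length
  exps i := (L.get i).2
  blocks i := (L.get i).1.toFinset

theorem toLaIndex_mem_laIndices {L : List (Multiset (Fin p) × ℕ)} (hL : IsReduced L) {W : ℕ}
    (hW : L.sum ≤ (Finset.univ.val, W)) : toLaIndex L ∈ laIndices p W := by
  refine ⟨?_, fun i => ?_, ?_, fun i => ?_⟩
  · exact (hL.length_le_card.trans (Multiset.card_le_card hW.1)).trans_eq (Finset.card_fin p)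
  · exact Nat.cast_le.2 (hL _ (L.get_mem i)).2
  · have hsum : ∑ i : Fin L.length, (L.get i).2 = L.sum.2 :=
      (Fin.sum_univ_fun_getElem L Prod.snd).trans (map_list_sum (AddMonoidHom.snd _ _) L).symm
    have hle : ∑ i : Fin L.length, (L.get i).2 ≤ W := hsum.trans_le hW.2
    simp only [toLaIndex]
    exact_mod_cast hle
  · exact Multiset.toFinset_nonempty.2 (hL _ (L.get_mem i)).1

theorem laFun_toLaIndex {L : List (Multiset (Fin p) × ℕ)} (hL : ∀ b ∈ L, b.1.Nodup)
    (z : Region p) : laFun (toLaIndex L) z =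
      La (fun i => ((L.get i).2 : ℤ)) fun i => blockProd (fun j => (z.1 j)⁻¹) (L.get i).1 := by
  refine congrArg (La _) (funext fun i => ((toLaIndex L).args_apply z.1 i).trans ?_)
  exact congrArg (blockProd _) (hL _ (L.get_mem i)).dedup

theorem nodup_of_sum_le {L : List (Multiset (Fin p) × ℕ)} {W : ℕ}
    (hW : L.sum ≤ (Finset.univ.val, W)) {b : Multiset (Fin p) × ℕ} (hb : b ∈ L) : b.1.Nodup :=
  Multiset.nodup_of_le ((List.le_sum_of_mem hb).trans hW).1 Finset.univ.nodup

theorem tendsto_evalAt_nestedPolylog {L : List (Multiset (Fin p) × ℕ)} (hL : IsReduced L)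
    (hL' : ∀ b ∈ L, b.1.Nodup) (z : Region p) :
    Tendsto (fun u => evalAt z (nestedPolylog (invCoord p) L u)) atTop
      (𝓝 (laFun (toLaIndex L) z)) := by
  simp only [map_nestedPolylog, evalAt_comp_invCoord, laFun_toLaIndex hL']
  exact tendsto_nestedPolylog z.norm_inv_lt_one hL

theorem tendsto_evalAt_zero_of_mem_geomTerms {B : Multiset (Fin p)} (hB : B ≠ 0) {w : ℕ}
    {g : ℕ → CoeffRing p} (hg : g ∈ geomTerms (blockProd (invCoord p) B) w) (z : Region p) :
    Tendsto (fun u => evalAt z (g u)) atTop (𝓝 0) := by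
  have hmap := map_mem_geomTerms (evalAt z) hg
  rw [evalAt_blockProd_invCoord] at hmap
  exact tendsto_zero_of_mem_geomTerms (norm_blockProd_lt_one z.norm_inv_lt_one hB) hmap

theorem exists_mem_span_laFun_tendsto {W : ℕ} {h : ℕ → CoeffRing p}
    (hh : h ∈ reducedSums (invCoord p) (Finset.univ.val, W)) :
    ∃ g ∈ Submodule.span (CoeffRing p) (laFun '' laIndices p W),
      ∀ z, Tendsto (fun u => evalAt z (h u)) atTop (𝓝 (g z)) := by
  induction hh using Submodule.span_induction with
  | mem h hh =>
    obtain ⟨L, hL, hW, rfl⟩ | ⟨b, L, g, hg, hb, hL, hW, rfl⟩ := hh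
    · exact ⟨_, Submodule.subset_span ⟨_, toLaIndex_mem_laIndices hL hW, rfl⟩,
        tendsto_evalAt_nestedPolylog hL fun _ => nodup_of_sum_le hW⟩
    · refine ⟨0, zero_mem _, fun z => ?_⟩
      have hnested := tendsto_evalAt_nestedPolylog hL
        (fun _ => nodup_of_sum_le (le_add_self.trans hW)) z
      simpa using (tendsto_evalAt_zero_of_mem_geomTerms hb hg z).mul hnested
  | zero => exact ⟨0, zero_mem _, fun z => by simp⟩
  | add h₁ h₂ _ _ ih₁ ih₂ =>
    obtain ⟨g₁, hg₁, hlim₁⟩ := ih₁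
    obtain ⟨g₂, hg₂, hlim₂⟩ := ih₂
    exact ⟨g₁ + g₂, add_mem hg₁ hg₂, fun z => by simpa using (hlim₁ z).add (hlim₂ z)⟩
  | smul a h _ ih =>
    obtain ⟨g, hg, hlim⟩ := ih
    exact ⟨a • g, Submodule.smul_mem _ a hg, fun z =>
      ((hlim z).const_mul (evalAt z a)).congr fun u => (map_mul (evalAt z) a (h u)).symm⟩

theorem nestedSum_geomTerm_mem_reducedSums (A : Fin p → ℕ) {ρ : Fin p → ℕ → ℚ}
    (hρ : ∀ j, ρ j ∈ rationalFunctions ℚ (A j)) :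
    nestedSum (List.ofFn fun j => geomTerm (invCoord p j) (ρ j)) ∈
      reducedSums (invCoord p) (Finset.univ.val, ∑ j, A j) := by
  let bs : List (Multiset (Fin p) × ℕ) := List.ofFn fun j => ({j}, A j)
  have hbs : bs.sum = (Finset.univ.val, ∑ j, A j) := by
    rw [List.sum_ofFn]
    ext1
    · rw [Prod.fst_sum, Finset.sum_multiset_singleton]
    · rw [Prod.snd_sum]
  rw [← hbs]
  refine nestedSum_mem_reducedSums isUnit_invCoord ?_ fun B hB hB0 =>
    isUnit_one_sub_blockProd_invCoord hB0 (Multiset.nodup_of_le hB (hbs ▸ Finset.univ.nodup))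
  refine List.forall₂_iff_get.2 ⟨by simp [bs], fun i _ _ => ?_⟩
  simpa [bs, blockProd] using geomTerm_mem_geomTerms _ (hρ _)

theorem evalAt_nestedSum_geomTerm (z : Region p) (ρ : Fin p → ℕ → ℚ) (u : ℕ) :
    evalAt z (nestedSum (List.ofFn fun j => geomTerm (invCoord p j) (ρ j)) u) =
      nestedSum (List.ofFn fun j => geomTerm (z.1 j)⁻¹ (ρ j)) u := by
  rw [← RingHom.coe_coe (evalAt z), map_nestedSum, List.map_ofFn]
  congr 2
  funext j k
  exact (map_geomTerm (evalAt z) _ _ k).trans (congrArg (geomTerm · _ k) (evalAt_invCoord z j))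

theorem exists_mem_span_laFun_hasSum_chainTerm (A : Fin p → ℕ) {ρ : Fin p → ℕ → ℚ}
    (hρ : ∀ j, ρ j ∈ rationalFunctions ℚ (A j)) :
    ∃ g ∈ Submodule.span (CoeffRing p) (laFun '' laIndices p (∑ j, A j)),
      ∀ z : Region p, HasSum (chainTerm fun j => geomTerm (z.1 j)⁻¹ (ρ j)) (g z) := by
  obtain ⟨g, hg, hlim⟩ :=
    exists_mem_span_laFun_tendsto (nestedSum_geomTerm_mem_reducedSums A hρ)
  refine ⟨g, hg, fun z => ?_⟩
  have hsummable j : Summable fun k => ‖geomTerm (z.1 j)⁻¹ (ρ j) k‖ :=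
    summable_norm_geomTerm (z.norm_inv_lt_one j) (hρ j)
  rw [tendsto_nhds_unique ((hlim z).congr (evalAt_nestedSum_geomTerm z ρ))
    (tendsto_nestedSum_ofFn hsummable)]
  exact (summable_chainTerm hsummable).hasSum

theorem eval_ascPochhammer_eq_prod {R : Type*} [CommSemiring R] (N : ℕ) (x : R) :
    (ascPochhammer R N).eval x = ∏ r ∈ Finset.range N, (x + r) := by
  induction N with
  | zero => simp
  | succ N ih => rw [ascPochhammer_succ_eval, ih, Finset.prod_range_succ]

theorem seriesTerm_monomial (m : Fin p →₀ ℕ) (a : ℚ) (A n : Fin p → ℕ) (z : Fin p → ℂ)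
    (k : chains p) :
    seriesTerm (MvPolynomial.monomial m a) A n z k =
      a * chainTerm (fun j => geomTerm (z j)⁻¹ (evalSucc ℚ (X ^ m j) *
        ∏ r ∈ Finset.range (n j + 1), invLinear ℚ r ^ A j)) k := by
  have hfactor j : geomTerm (z j)⁻¹ (evalSucc ℚ (X ^ m j) *
        ∏ r ∈ Finset.range (n j + 1), invLinear ℚ r ^ A j) (k.1 j - 1) =
      (k.1 j : ℂ) ^ m j / (ascPochhammer ℂ (n j + 1)).eval (k.1 j : ℂ) ^ A j *
        z j ^ (-(k.1 j : ℤ)) := by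
    obtain ⟨l, hl⟩ := Nat.exists_eq_succ_of_ne_zero (Nat.one_le_iff_ne_zero.1 (k.2.2 j))
    rw [zpow_neg, zpow_natCast]
    simp [hl, geomTerm_apply, evalSucc_apply, invLinear, eval_ascPochhammer_eq_prod,
      Finset.prod_pow, div_eq_mul_inv]
  simp only [seriesTerm, chainTerm, hfactor, MvPolynomial.aeval_monomial,
    Finsupp.prod_fintype _ _ fun _ => pow_zero _, Finset.prod_mul_distrib, Finset.prod_div_distrib,
    eq_ratCast, mul_assoc, mul_div_assoc]

theorem seriesTerm_add (P Q : MvPolynomial (Fin p) ℚ) (A n : Fin p → ℕ) (z : Fin p → ℂ)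
    (k : chains p) :
    seriesTerm (P + Q) A n z k = seriesTerm P A n z k + seriesTerm Q A n z k := by
  simp only [seriesTerm, map_add, add_div, add_mul]

theorem exists_mem_span_laFun_hasSum_seriesTerm (P : MvPolynomial (Fin p) ℚ) (A n : Fin p → ℕ) :
    ∃ g ∈ Submodule.span (CoeffRing p) (laFun '' laIndices p (∑ j, A j)),
      ∀ z : Region p, HasSum (seriesTerm P A n z.1) (g z) := by
  induction P using MvPolynomial.induction_on' with
  | monomial m a =>
    obtain ⟨g, hg, hsum⟩ := exists_mem_span_laFun_hasSum_chainTerm A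
      (ρ := fun j => evalSucc ℚ (X ^ m j) * ∏ r ∈ Finset.range (n j + 1), invLinear ℚ r ^ A j)
      fun j => ⟨_, _, rfl⟩
    refine ⟨algebraMap ℚ (CoeffRing p) a • g, Submodule.smul_mem _ _ hg, fun z => ?_⟩
    exact ((hsum z).mul_left (a : ℂ)).congr_fun fun k => seriesTerm_monomial m a A n z.1 k
  | add P Q hP hQ =>
    obtain ⟨f, hf, hfP⟩ := hP
    obtain ⟨g, hg, hgQ⟩ := hQ
    refine ⟨f + g, add_mem hf hg, fun z => ?_⟩
    exact ((hfP z).add (hgQ z)).congr_fun (seriesTerm_add P Q A n z.1)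

end Series

end MultPolylog

end

theorem mainTheorem3 (p : ℕ) (hp : 1 ≤ p) (P : MvPolynomial (Fin p) ℚ) (A n : Fin p → ℕ)
    (hA : ∀ j, 1 ≤ A j) :
    ∃ c : MultPolylog.LaIndex p →₀ MvPolynomial (MultPolylog.CoeffVar p) ℚ,
      (∀ t ∈ c.support,
        t.depth ≤ p ∧ (∀ i, 1 ≤ t.exps i) ∧ (∑ i, t.exps i ≤ ∑ j, (A j : ℤ)) ∧
          ∀ i, (t.blocks i).Nonempty) ∧
      ∀ z : Fin p → ℂ, (∀ j, 1 < ‖z j‖) →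
        (∀ t ∈ c.support, Summable (MultPolylog.laTerm t.exps (t.args z))) ∧
        HasSum (MultPolylog.seriesTerm P A n z)
          (c.sum fun t f =>
            MvPolynomial.aeval (MultPolylog.CoeffVar.value z) f *
              MultPolylog.La t.exps (t.args z)) := by
  obtain ⟨g, hg, hsum⟩ := MultPolylog.exists_mem_span_laFun_hasSum_seriesTerm P A n
  obtain ⟨c, hc, rfl⟩ :=
    MultPolylog.exists_finsupp_of_mem_span_range (MultPolylog.coeffHom p) hg
  refine ⟨c, fun t ht => ?_, fun z hz => ⟨fun t ht => ?_, ?_⟩⟩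
  · exact_mod_cast hc ht
  · obtain ⟨-, hexps, -, hblocks⟩ := hc ht
    exact MultPolylog.summable_laTerm (fun i => zero_le_one.trans (hexps i))
      (MultPolylog.norm_args_lt_one hblocks ⟨z, hz⟩)
  · convert hsum ⟨z, hz⟩ using 1
    simp only [Finsupp.sum, Finset.sum_apply, Pi.mul_apply, MultPolylog.coeffHom_apply]
    rfl
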